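/- **Conventions.** A *graph* $\Gamma=(V,F,\partial,i)$ consists of finite sets $V$ of vertices and $F$ of flags, a map $\partial:F\to V$ and an involution $i$ of $F$ (with $i^2=\mathrm{id}$); the two-element orbits of $i$ are the edges, its fixed points are the tails. An *aggregate* is a graph without edges, and a *corolla* is an aggregate with exactly one vertex. A morphism $\phi:X\to Y$ in the category $\mathcal Agg$ is a triple $(\phi^F,\phi_V,i_\phi)$ of an injection $\phi^F:F_Y\to F_X$, a surjection $\phi_V:V_X\to V_Y$ and a fixed point free involution $i_\phi$ of $F_X\setminus\phi^F(F_Y)$, such that $\phi_V(\partial\phi^F(f))=\partial f$ for $f\in F_Y$ and $\phi_V(\partial f)=\phi_V(\partial i_\phi(f))$ for $f\in F_X\setminus\phi^F(F_Y)$. Composition is $(\psi\circ\phi)^F=\phi^F\circ\psi^F$, $(\psi\circ\phi)_V=\psi_V\circ\phi_V$, and the orbits of $i_{\psi\circ\phi}$ are those of $i_\phi$ and the images under $\phi^F$ of those of $i_\psi$. The *ghost graph* $\Gamma(\phi)$ has the vertices, flags and incidence map of $X$, and its involution is $i_\phi$, extended by the identity to $\phi^F(F_Y)$. The wide subcategory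 $\mathcal Agg^{ctd}$ consists of those $\phi:X\to Y$ for which, for every $v\in V_Y$, the part of $\Gamma(\phi)$ over $v$, with vertex set $\phi_V^{-1}(v)$, is connected. A *subgraph* $\Gamma_1\subset\Gamma$ has all vertices and all flags of $\Gamma$ and a subset of its edges (the flags of the remaining edges become tails). The quotient $\Gamma/\Gamma_1$ is obtained by contracting each connected component of $\Gamma_1$ to a vertex: its vertices are these components and its flags are the flags that do not belong to an edge of $\Gamma_1$, with the incidence map and involution induced by $\Gamma$. A graph is *connected* if it is nonempty and any two of its vertices are joined by a path of edges. For a category $\mathcal F$, let $\mathscr B^{iso}$ be the free abelian group on the isomorphism classes $[\phi]$ of morphisms (isomorphism in the arrow category). Decompositions $\phi=\phi_0\circ\phi_1$ and $\phi=\phi_0'\circ\phi_1'$ with middle objects $Y$ and $Y'$ are equivalent if $\phi_0'=\phi_0\sigma^{-1}$ and $\phi_1'=\sigma\phi_1$ for an isomorphism $\sigma:Y\to Y'$. If every morphism has finitely many equivalence classes of decompositions, then $$\Delta^{iso}([\phi])=\sum_{[(\phi_0,\phi_1)]}[\phi_0]\otimes[\phi_1]$$ (summed over the equivalence classes of decompositions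 of the fixed representative $\phi$) is a well-defined linear map $\mathscr B^{iso}\to\mathscr B^{iso}\otimes\mathscr B^{iso}$. **Proposition (graph coproduct).** In $\mathcal Agg^{ctd}$: 1. $[\phi]\mapsto[\Gamma(\phi)]$ is a bijection from the isomorphism classes of morphisms of $\mathcal Agg^{ctd}$ to the isomorphism classes of graphs. Via this bijection we identify the two and write $\Gamma$ for the corresponding basis element of $\mathscr B^{iso}$. 2. Every morphism of $\mathcal Agg^{ctd}$ has only finitely many equivalence classes of decompositions, and for every graph $\Gamma$ $$\Delta^{iso}(\Gamma)=\sum_{\Gamma_1\subset\Gamma}\Gamma/\Gamma_1\otimes\Gamma_1 ,$$ summed over all subgraphs. Thus $\Delta^{iso}$ is the (core) Connes–Kreimer coproduct $[\Gamma]\mapsto\sum_{\Gamma_1\subset\Gamma}[\Gamma/\Gamma_1]\otimes[\Gamma_1]$ on the free abelian group on isomorphism classes of graphs. 3. For every morphism $\phi$, the assignment $[(\phi_0,\phi_1)]\mapsto\Gamma_1=\Gamma(\phi_1)$ is a bijection from the equivalence classes of decompositions of $\phi$ to the subgraphs of $\Gamma(\phi)$, and $\Gamma(\phi_0)\cong\Gamma(\phi)/\Gamma_1$.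 4. The action $\sigma\cdot(\phi_0,\phi_1)=(\phi_0\sigma^{-1},\sigma\phi_1)$ of the automorphisms of the middle object on the decompositions of a morphism is free. 5. If $\Gamma$ is connected, then so is $\Gamma/\Gamma_1$ for every subgraph $\Gamma_1\subset\Gamma$, and both are isomorphism classes of objects of $(\mathcal Agg^{ctd}\downarrow\mathcal Crl)$, i.e. of morphisms whose target is a corolla. -/

import Mathlib

open CategoryTheory
open scoped TensorProduct

universe v w u

/-! ### The coproduct on isomorphism classes of morphisms of a category -/

section IsoCoproduct

variable (C : Type w) [Category.{v} C]

/-- Isomorphism classes `[φ]` of morphisms of `C`, i.e. isomorphism classes of objects of the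
arrow category: `φ ∼ ψ` when `σ' ∘ φ = ψ ∘ σ` for some isomorphisms `σ, σ'`. -/
abbrev MorClass : Type (max w v) := Quotient (isIsomorphicSetoid (Arrow C))

/-- `𝓑^iso`, the free abelian group on the isomorphism classes of morphisms. -/
abbrev BIso : Type (max w v) := MorClass C →₀ ℤ

variable {C}

/-- The isomorphism class of a morphism. -/
def morClass {X Y : C} (f : X ⟶ Y) : MorClass C :=
  Quotient.mk (isIsomorphicSetoid (Arrow C)) (Arrow.mk f)

/-- Classes `[(φ₀, φ₁)]` of decompositions `φ = φ₀ ∘ φ₁` of a fixed morphism `φ : X ⟶ Z`, where a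
`Factorisation` `d` has `d.ι = φ₁ : X ⟶ Y` and `d.π = φ₀ : Y ⟶ Z`. Isomorphic factorisations are
those that differ by the action `(φ₀, φ₁) ↦ (φ₀ ∘ σ⁻¹, σ ∘ φ₁)` of an isomorphism
`σ : Y ≅ Y'` of middle objects. -/
abbrev DecompClass {X Z : C} (f : X ⟶ Z) : Type (max w v) :=
  Quotient (isIsomorphicSetoid (Factorisation f))

/-- The class `[(φ₀, φ₁)]` of a decomposition. -/
def decompClass {X Z : C} {f : X ⟶ Z} (d : Factorisation f) : DecompClass f :=
  Quotient.mk (isIsomorphicSetoid (Factorisation f)) d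

/-- The term `[φ₀] ⊗ [φ₁]` of a class `[(φ₀, φ₁)]` of decompositions. -/
noncomputable def decompTerm {X Z : C} {f : X ⟶ Z} : DecompClass f → BIso C ⊗[ℤ] BIso C :=
  Quotient.lift
    (fun d => Finsupp.single (morClass d.π) 1 ⊗ₜ[ℤ] Finsupp.single (morClass d.ι) 1)
    (by
      rintro d e ⟨i⟩
      have h1 : morClass d.π = morClass e.π :=
        Quotient.sound ⟨Arrow.isoMk
          { hom := i.hom.h
            inv := i.inv.h
            hom_inv_id := congrArg Factorisation.Hom.h i.hom_inv_id
            inv_hom_id := congrArg Factorisation.Hom.h i.inv_hom_id } (Iso.refl _)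
          (by simp)⟩
      have h2 : morClass d.ι = morClass e.ι :=
        Quotient.sound ⟨Arrow.isoMk (Iso.refl _)
          { hom := i.hom.h
            inv := i.inv.h
            hom_inv_id := congrArg Factorisation.Hom.h i.hom_inv_id
            inv_hom_id := congrArg Factorisation.Hom.h i.inv_hom_id }
          (by simp)⟩
      simp only [h1, h2])

/-- `∑ [φ₀] ⊗ [φ₁]` over the classes of decompositions of the fixed morphism `φ`. (The sum is
meaningful when there are finitely many classes.) -/
noncomputable def decompSum {X Z : C} (f : X ⟶ Z) : BIso C ⊗[ℤ] BIso C :=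
  ∑ᶠ c : DecompClass f, decompTerm c

/-- Transport of a decomposition along an isomorphism of morphisms. -/
def transportDecomp {φ ψ : Arrow C} (i : φ ≅ ψ) (d : Factorisation φ.hom) :
    Factorisation ψ.hom where
  mid := d.mid
  ι := i.inv.left ≫ d.ι
  π := d.π ≫ i.hom.right
  ι_π := by simp

/-- Transport of classes of decompositions along an isomorphism of morphisms. -/
def transportDecompClass {φ ψ : Arrow C} (i : φ ≅ ψ) : DecompClass φ.hom → DecompClass ψ.hom :=
  Quotient.map (transportDecomp i) (by
    rintro d e ⟨j⟩
    exact ⟨{ hom := { h := j.hom.h, ι_h := by simp [transportDecomp],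
                      h_π := by simp [transportDecomp] }
             inv := { h := j.inv.h, ι_h := by simp [transportDecomp],
                      h_π := by simp [transportDecomp] }
             hom_inv_id := Factorisation.Hom.ext (by
               have h := congrArg Factorisation.Hom.h j.hom_inv_id
               exact h)
             inv_hom_id := Factorisation.Hom.ext (by
               have h := congrArg Factorisation.Hom.h j.inv_hom_id
               exact h) }⟩)

theorem transportDecomp_symm {φ ψ : Arrow C} (i : φ ≅ ψ) (d : Factorisation φ.hom) :
    transportDecomp i.symm (transportDecomp i d) = d := by
  obtain ⟨m, a, b, h⟩ := d
  simp [transportDecomp]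

theorem transportDecompClass_symm {φ ψ : Arrow C} (i : φ ≅ ψ) (c : DecompClass φ.hom) :
    transportDecompClass i.symm (transportDecompClass i c) = c := by
  induction c using Quotient.inductionOn with
  | h d => exact congrArg (Quotient.mk _) (transportDecomp_symm i d)

theorem decompTerm_transport {φ ψ : Arrow C} (i : φ ≅ ψ) (c : DecompClass φ.hom) :
    decompTerm (transportDecompClass i c) = decompTerm c := by
  induction c using Quotient.inductionOn with
  | h d =>
    have h1 : morClass (d.π ≫ i.hom.right) = morClass d.π :=
      Quotient.sound ⟨Arrow.isoMk (Iso.refl _) (asIso i.inv.right) (by simp)⟩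
    have h2 : morClass (i.inv.left ≫ d.ι) = morClass d.ι :=
      Quotient.sound ⟨Arrow.isoMk (asIso i.inv.left) (Iso.refl _) (by simp)⟩
    change Finsupp.single (morClass (d.π ≫ i.hom.right)) (1 : ℤ) ⊗ₜ[ℤ]
      Finsupp.single (morClass (i.inv.left ≫ d.ι)) (1 : ℤ) = _
    rw [h1, h2]
    rfl

theorem decompSum_eq_of_iso {φ ψ : Arrow C} (i : φ ≅ ψ) : decompSum φ.hom = decompSum ψ.hom :=
  finsum_eq_of_bijective (transportDecompClass i)
    (Function.bijective_iff_has_inverse.2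
      ⟨transportDecompClass i.symm, transportDecompClass_symm i, transportDecompClass_symm i.symm⟩)
    (fun c => (decompTerm_transport i c).symm)

variable (C)

/-- The coproduct `Δ^iso : 𝓑^iso → 𝓑^iso ⊗ 𝓑^iso`,
`Δ^iso [φ] = ∑_{[(φ₀, φ₁)]} [φ₀] ⊗ [φ₁]`, the sum running over the classes of decompositions of a
representative `φ`. -/
noncomputable def deltaIso : BIso C →ₗ[ℤ] BIso C ⊗[ℤ] BIso C :=
  Finsupp.linearCombination ℤ
    (Quotient.lift (fun φ : Arrow C => decompSum φ.hom)
      (by rintro φ ψ ⟨i⟩; exact decompSum_eq_of_iso i))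

end IsoCoproduct

/-! ### Graphs -/

/-- A finite graph `(V, F, ∂, i)`: flags (half edges) `F`, incidence `∂ : F → V` and an involution
`i` of the flags. The orbits of `i` of order two are the edges, the fixed points the tails. -/
structure BMGraph where
  V : Type u
  F : Type u
  [finV : Finite V]
  [finF : Finite F]
  bdry : F → V
  inv : F → F
  inv_inv : ∀ f, inv (inv f) = f

attribute [instance] BMGraph.finV BMGraph.finF

namespace BMGraph

/-- An isomorphism of graphs. -/
structure Iso (Γ Γ' : BMGraph.{u}) where
  onV : Γ.V ≃ Γ'.V
  onF : Γ.F ≃ Γ'.F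
  bdry_onF : ∀ f, Γ'.bdry (onF f) = onV (Γ.bdry f)
  inv_onF : ∀ f, Γ'.inv (onF f) = onF (Γ.inv f)

def Iso.refl (Γ : BMGraph.{u}) : Iso Γ Γ :=
  ⟨Equiv.refl _, Equiv.refl _, fun _ => rfl, fun _ => rfl⟩

def Iso.symm {Γ Γ' : BMGraph.{u}} (e : Iso Γ Γ') : Iso Γ' Γ :=
  ⟨e.onV.symm, e.onF.symm,
    fun f => by rw [Equiv.eq_symm_apply, ← e.bdry_onF, Equiv.apply_symm_apply],
    fun f => by rw [Equiv.eq_symm_apply, ← e.inv_onF, Equiv.apply_symm_apply]⟩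

def Iso.trans {Γ Γ' Γ'' : BMGraph.{u}} (e : Iso Γ Γ') (e' : Iso Γ' Γ'') : Iso Γ Γ'' :=
  ⟨e.onV.trans e'.onV, e.onF.trans e'.onF,
    fun f => by simp [e.bdry_onF, e'.bdry_onF],
    fun f => by simp [e.inv_onF, e'.inv_onF]⟩

/-- The relation of being isomorphic graphs. -/
def isoSetoid : Setoid BMGraph.{u} where
  r Γ Γ' := Nonempty (Iso Γ Γ')
  iseqv := ⟨fun Γ => ⟨Iso.refl Γ⟩, fun ⟨e⟩ => ⟨e.symm⟩, fun ⟨e⟩ ⟨e'⟩ => ⟨e.trans e'⟩⟩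

/-- Isomorphism classes of graphs. -/
abbrev Class : Type (u + 1) := Quotient isoSetoid.{u}

/-- The isomorphism class of a graph. -/
def toClass (Γ : BMGraph.{u}) : Class.{u} := Quotient.mk isoSetoid Γ

/-- The equivalence relation on vertices generated by `∂ f ∼ ∂ (i f)`: two vertices are related
when they are joined by a path of edges, that is, lie in the same connected component. -/
def componentSetoid (Γ : BMGraph.{u}) : Setoid Γ.V :=
  Relation.EqvGen.setoid (fun v w => ∃ f, Γ.bdry f = v ∧ Γ.bdry (Γ.inv f) = w)

/-- A graph is connected if it is nonempty and any two vertices are joined by a path. -/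
def Connected (Γ : BMGraph.{u}) : Prop :=
  Nonempty Γ.V ∧ ∀ v w, Γ.componentSetoid v w

/-- A subgraph `Γ₁ ⊂ Γ`, given by a subset of the edges of `Γ`: it has the vertices and flags of `Γ`,
and each flag either keeps its partner (an edge that belongs to `Γ₁`) or becomes a tail (an edge
that does not). -/
@[ext]
structure Subgraph (Γ : BMGraph.{u}) where
  inv : Γ.F → Γ.F
  inv_inv : ∀ f, inv (inv f) = f
  inv_eq : ∀ f, inv f = f ∨ inv f = Γ.inv f

namespace Subgraph

instance (Γ : BMGraph.{u}) : Finite Γ.Subgraph :=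
  Finite.of_injective (Subgraph.inv : Γ.Subgraph → (Γ.F → Γ.F)) (fun _ _ h => Subgraph.ext h)

noncomputable instance (Γ : BMGraph.{u}) : Fintype Γ.Subgraph := Fintype.ofFinite _

/-- A subgraph as a graph. -/
def toGraph {Γ : BMGraph.{u}} (S : Γ.Subgraph) : BMGraph.{u} where
  V := Γ.V
  F := Γ.F
  bdry := Γ.bdry
  inv := S.inv
  inv_inv := S.inv_inv

theorem inv_tail {Γ : BMGraph.{u}} (S : Γ.Subgraph) {f : Γ.F} (hf : S.inv f = f) :
    S.inv (Γ.inv f) = Γ.inv f := by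
  rcases S.inv_eq (Γ.inv f) with h | h
  · exact h
  · rw [Γ.inv_inv] at h
    have h' := S.inv_inv (Γ.inv f)
    rw [h, hf] at h'
    rw [← h', hf]

/-- The quotient graph `Γ / Γ₁`, obtained by contracting each connected component of `Γ₁` to a
vertex: its flags are those that are not part of an edge of `Γ₁`. -/
def quotient {Γ : BMGraph.{u}} (S : Γ.Subgraph) : BMGraph.{u} where
  V := Quotient S.toGraph.componentSetoid
  F := { f : Γ.F // S.inv f = f }
  bdry f := Quotient.mk _ (Γ.bdry f.1)
  inv f := ⟨Γ.inv f.1, S.inv_tail f.2⟩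
  inv_inv f := Subtype.ext (Γ.inv_inv f.1)

/-- Transport of a subgraph along an isomorphism of graphs. -/
def transport {Γ Γ' : BMGraph.{u}} (e : Iso Γ Γ') (S : Γ.Subgraph) : Γ'.Subgraph where
  inv f := e.onF (S.inv (e.onF.symm f))
  inv_inv f := by simp [S.inv_inv]
  inv_eq f := by
    rcases S.inv_eq (e.onF.symm f) with h | h
    · left; rw [h, Equiv.apply_symm_apply]
    · right; rw [h, ← e.inv_onF, Equiv.apply_symm_apply]

theorem transport_symm {Γ Γ' : BMGraph.{u}} (e : Iso Γ Γ') (S : Γ.Subgraph) :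
    transport e.symm (transport e S) = S := by
  apply Subgraph.ext
  funext f
  simp [transport, Iso.symm]

def toGraphIso {Γ Γ' : BMGraph.{u}} (e : Iso Γ Γ') (S : Γ.Subgraph) :
    Iso S.toGraph (transport e S).toGraph where
  onV := e.onV
  onF := e.onF
  bdry_onF := e.bdry_onF
  inv_onF f := congrArg (fun x => e.onF (S.inv x)) (e.onF.symm_apply_apply f)

theorem componentSetoid_map {Γ Γ' : BMGraph.{u}} (e : Iso Γ Γ') {v w : Γ.V}
    (h : Γ.componentSetoid v w) : Γ'.componentSetoid (e.onV v) (e.onV w) := by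
  induction h with
  | rel x y h =>
    obtain ⟨f, rfl, rfl⟩ := h
    exact Relation.EqvGen.rel _ _ ⟨e.onF f, e.bdry_onF f, by rw [e.inv_onF, e.bdry_onF]⟩
  | refl x => exact Relation.EqvGen.refl _
  | symm x y _ ih => exact Relation.EqvGen.symm _ _ ih
  | trans x y z _ _ ih ih' => exact Relation.EqvGen.trans _ _ _ ih ih'

theorem componentSetoid_iff {Γ Γ' : BMGraph.{u}} (e : Iso Γ Γ') (v w : Γ.V) :
    Γ.componentSetoid v w ↔ Γ'.componentSetoid (e.onV v) (e.onV w) := by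
  refine ⟨componentSetoid_map e, fun h => ?_⟩
  have h' := componentSetoid_map e.symm h
  change Γ.componentSetoid (e.onV.symm (e.onV v)) (e.onV.symm (e.onV w)) at h'
  rwa [Equiv.symm_apply_apply, Equiv.symm_apply_apply] at h'

def quotientIso {Γ Γ' : BMGraph.{u}} (e : Iso Γ Γ') (S : Γ.Subgraph) :
    Iso S.quotient (transport e S).quotient where
  onV := Quotient.congr e.onV (componentSetoid_iff (toGraphIso e S))
  onF := e.onF.subtypeEquiv (fun f => by simp [transport])
  bdry_onF f := by
    change Quotient.mk (transport e S).toGraph.componentSetoid (Γ'.bdry (e.onF f.1)) =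
      Quotient.mk (transport e S).toGraph.componentSetoid (e.onV (Γ.bdry f.1))
    rw [e.bdry_onF]
  inv_onF f := Subtype.ext (e.inv_onF f.1)

end Subgraph

/-- `∑_{Γ₁ ⊂ Γ} [Γ / Γ₁] ⊗ [Γ₁]`. -/
noncomputable def subgraphSum (Γ : BMGraph.{u}) : (Class.{u} →₀ ℤ) ⊗[ℤ] (Class.{u} →₀ ℤ) :=
  ∑ Γ₁ : Γ.Subgraph,
    Finsupp.single Γ₁.quotient.toClass 1 ⊗ₜ[ℤ] Finsupp.single Γ₁.toGraph.toClass 1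

theorem subgraphSum_eq_of_iso {Γ Γ' : BMGraph.{u}} (e : Iso Γ Γ') :
    subgraphSum Γ = subgraphSum Γ' := by
  refine Fintype.sum_bijective (Subgraph.transport e)
    (Function.bijective_iff_has_inverse.2 ⟨Subgraph.transport e.symm,
      Subgraph.transport_symm e, Subgraph.transport_symm e.symm⟩) _ _ (fun S => ?_)
  have h1 : S.quotient.toClass = (Subgraph.transport e S).quotient.toClass :=
    Quotient.sound ⟨Subgraph.quotientIso e S⟩
  have h2 : S.toGraph.toClass = (Subgraph.transport e S).toGraph.toClass :=
    Quotient.sound ⟨Subgraph.toGraphIso e S⟩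
  rw [h1, h2]

/-- The (core) Connes–Kreimer coproduct of graphs, on the free abelian group on isomorphism classes
of graphs: `[Γ] ↦ ∑_{Γ₁ ⊂ Γ} [Γ / Γ₁] ⊗ [Γ₁]`. -/
noncomputable def connesKreimerCoproduct :
    (Class.{u} →₀ ℤ) →ₗ[ℤ] (Class.{u} →₀ ℤ) ⊗[ℤ] (Class.{u} →₀ ℤ) :=
  Finsupp.linearCombination ℤ
    (Quotient.lift subgraphSum (by rintro Γ Γ' ⟨e⟩; exact subgraphSum_eq_of_iso e))

end BMGraph

/-! ### The category of aggregates of corollas -/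

/-- An aggregate of corollas: a graph without edges. -/
structure Aggregate extends BMGraph.{u} where
  no_edges : ∀ f, toBMGraph.inv f = f

namespace Aggregate

/-- A corolla is an aggregate with exactly one vertex. -/
def IsCorolla (X : Aggregate.{u}) : Prop := ∃! _v : X.V, True

/-- A Borisov–Manin morphism `(φ^F, φ_V, i_φ)` of aggregates. The fixed point free involution `i_φ`
of the flags of the source outside the image of `φ^F` (all of which are tails) is recorded as the
involution `ghost` of all flags of the source that extends it by the identity, so its fixed points
are exactly the image of `φ^F`. Orbits `{f, ghost f}` of order two are the ghost edges. -/
@[ext]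
structure Hom (X Y : Aggregate.{u}) where
  flagMap : Y.F → X.F
  vertMap : X.V → Y.V
  ghost : X.F → X.F
  flagMap_injective : Function.Injective flagMap
  vertMap_surjective : Function.Surjective vertMap
  ghost_ghost : ∀ f, ghost (ghost f) = f
  ghost_eq_self_iff : ∀ f, ghost f = f ↔ f ∈ Set.range flagMap
  bdry_flagMap : ∀ f, vertMap (X.bdry (flagMap f)) = Y.bdry f
  bdry_ghost : ∀ f, vertMap (X.bdry (ghost f)) = vertMap (X.bdry f)

def Hom.id (X : Aggregate.{u}) : Hom X X where
  flagMap := _root_.id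
  vertMap := _root_.id
  ghost := _root_.id
  flagMap_injective := Function.injective_id
  vertMap_surjective := Function.surjective_id
  ghost_ghost _ := rfl
  ghost_eq_self_iff f := by simp
  bdry_flagMap _ := rfl
  bdry_ghost _ := rfl

theorem Hom.ghost_flagMap {X Y : Aggregate.{u}} (φ : Hom X Y) (f : Y.F) :
    φ.ghost (φ.flagMap f) = φ.flagMap f :=
  (φ.ghost_eq_self_iff _).2 ⟨f, rfl⟩

theorem Hom.ghost_not_mem {X Y : Aggregate.{u}} (φ : Hom X Y) {f : X.F}
    (hf : f ∉ Set.range φ.flagMap) : φ.ghost f ∉ Set.range φ.flagMap := fun h => by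
  rw [← φ.ghost_eq_self_iff, φ.ghost_ghost] at h
  exact hf ((φ.ghost_eq_self_iff f).1 h.symm)

/-- The ghost involution of a composite: the ghost edges are those of `φ` together with the images
under `φ^F` of those of `ψ`. -/
noncomputable def Hom.compGhost {X Y Z : Aggregate.{u}} (φ : Hom X Y) (ψ : Hom Y Z) : X.F → X.F :=
  Function.extend φ.flagMap (fun f => φ.flagMap (ψ.ghost f)) φ.ghost

theorem Hom.compGhost_flagMap {X Y Z : Aggregate.{u}} (φ : Hom X Y) (ψ : Hom Y Z) (f : Y.F) :
    φ.compGhost ψ (φ.flagMap f) = φ.flagMap (ψ.ghost f) :=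
  φ.flagMap_injective.extend_apply _ _ f

theorem Hom.compGhost_of_not_mem {X Y Z : Aggregate.{u}} (φ : Hom X Y) (ψ : Hom Y Z) {f : X.F}
    (hf : f ∉ Set.range φ.flagMap) : φ.compGhost ψ f = φ.ghost f :=
  Function.extend_apply' _ _ _ hf

/-- The composite `ψ ∘ φ = (φ^F ∘ ψ^F, ψ_V ∘ φ_V, i)`. -/
noncomputable def Hom.comp {X Y Z : Aggregate.{u}} (φ : Hom X Y) (ψ : Hom Y Z) : Hom X Z where
  flagMap := φ.flagMap ∘ ψ.flagMap
  vertMap := ψ.vertMap ∘ φ.vertMap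
  ghost := φ.compGhost ψ
  flagMap_injective := φ.flagMap_injective.comp ψ.flagMap_injective
  vertMap_surjective := ψ.vertMap_surjective.comp φ.vertMap_surjective
  ghost_ghost f := by
    by_cases hf : f ∈ Set.range φ.flagMap
    · obtain ⟨f, rfl⟩ := hf
      simp only [φ.compGhost_flagMap, ψ.ghost_ghost]
    · rw [φ.compGhost_of_not_mem ψ hf, φ.compGhost_of_not_mem ψ (φ.ghost_not_mem hf), φ.ghost_ghost]
  ghost_eq_self_iff f := by
    by_cases hf : f ∈ Set.range φ.flagMap
    · obtain ⟨f, rfl⟩ := hf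
      rw [φ.compGhost_flagMap, φ.flagMap_injective.eq_iff, ψ.ghost_eq_self_iff]
      simp [φ.flagMap_injective.eq_iff]
    · rw [φ.compGhost_of_not_mem ψ hf, φ.ghost_eq_self_iff]
      exact ⟨fun h => absurd h hf, fun ⟨g, hg⟩ => ⟨ψ.flagMap g, hg⟩⟩
  bdry_flagMap f := by simp [φ.bdry_flagMap, ψ.bdry_flagMap]
  bdry_ghost f := by
    by_cases hf : f ∈ Set.range φ.flagMap
    · obtain ⟨f, rfl⟩ := hf
      simp [φ.compGhost_flagMap, φ.bdry_flagMap, ψ.bdry_ghost]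
    · simp [φ.compGhost_of_not_mem ψ hf, φ.bdry_ghost]

/-- The category `Agg` of aggregates of corollas and Borisov–Manin morphisms. -/
noncomputable instance : Category.{u} Aggregate.{u} where
  Hom X Y := Hom X Y
  id X := Hom.id X
  comp φ ψ := Hom.comp φ ψ
  id_comp {X Y} φ := by
    refine Hom.ext rfl rfl (funext fun f => ?_)
    exact (Hom.id X).compGhost_flagMap φ f
  comp_id {X Y} φ := by
    refine Hom.ext rfl rfl (funext fun f => ?_)
    change φ.compGhost (Hom.id Y) f = φ.ghost f
    by_cases hf : f ∈ Set.range φ.flagMap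
    · obtain ⟨f, rfl⟩ := hf
      rw [φ.compGhost_flagMap, φ.ghost_flagMap]
      rfl
    · exact φ.compGhost_of_not_mem _ hf
  assoc {W X Y Z} φ ψ χ := by
    refine Hom.ext rfl rfl (funext fun f => ?_)
    change (φ.comp ψ).compGhost χ f = φ.compGhost (ψ.comp χ) f
    by_cases hf : f ∈ Set.range φ.flagMap
    · obtain ⟨f, rfl⟩ := hf
      rw [φ.compGhost_flagMap]
      change _ = φ.flagMap (ψ.compGhost χ f)
      by_cases hf : f ∈ Set.range ψ.flagMap
      · obtain ⟨f, rfl⟩ := hf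
        rw [ψ.compGhost_flagMap]
        exact (φ.comp ψ).compGhost_flagMap χ f
      · rw [ψ.compGhost_of_not_mem χ hf, (φ.comp ψ).compGhost_of_not_mem χ]
        · change φ.compGhost ψ (φ.flagMap f) = _
          rw [φ.compGhost_flagMap]
        · rintro ⟨g, hg⟩
          exact hf ⟨g, φ.flagMap_injective hg⟩
    · rw [φ.compGhost_of_not_mem _ hf, (φ.comp ψ).compGhost_of_not_mem χ]
      · exact φ.compGhost_of_not_mem ψ hf
      · rintro ⟨g, hg⟩
        exact hf ⟨ψ.flagMap g, hg⟩

/-- The ghost graph of a morphism of aggregates: vertices and flags are those of the source, edges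
are the ghost edges. -/
def ghostGraph {X Y : Aggregate.{u}} (φ : X ⟶ Y) : BMGraph.{u} where
  V := X.V
  F := X.F
  bdry := X.bdry
  inv := Hom.ghost φ
  inv_inv := Hom.ghost_ghost φ

/-- The morphisms of `Agg^ctd`: for each vertex `v` of the target, the ghost graph of the part of
`φ` over the corolla of `v` is connected. This part has as vertices the fibre of `φ_V` over `v`,
which is nonempty and is a union of connected components of the ghost graph of `φ`. -/
def ctd : MorphismProperty Aggregate.{u} := fun _ _ φ =>
  ∀ v w, Hom.vertMap φ v = Hom.vertMap φ w → (ghostGraph φ).componentSetoid v w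

theorem componentSetoid_comp_of_right {X Y Z : Aggregate.{u}} (φ : X ⟶ Y) (ψ : Y ⟶ Z)
    (hφ : ctd φ) {a b : Y.V} (h : (ghostGraph ψ).componentSetoid a b) :
    ∀ v w, Hom.vertMap φ v = a → Hom.vertMap φ w = b →
      (ghostGraph (φ ≫ ψ)).componentSetoid v w := by
  have key : ∀ v w, (ghostGraph φ).componentSetoid v w →
      (ghostGraph (φ ≫ ψ)).componentSetoid v w := by
    intro v w h
    induction h with
    | rel x y h =>
      obtain ⟨f, rfl, rfl⟩ := h
      by_cases hf : f ∈ Set.range (Hom.flagMap φ)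
      · have : Hom.ghost φ f = f := (Hom.ghost_eq_self_iff φ f).2 hf
        change Relation.EqvGen _ (X.bdry f) (X.bdry (Hom.ghost φ f))
        rw [this]
        exact Relation.EqvGen.refl _
      · refine Relation.EqvGen.rel _ _ ⟨f, rfl, ?_⟩
        exact congrArg X.bdry (Hom.compGhost_of_not_mem φ ψ hf)
    | refl x => exact Relation.EqvGen.refl _
    | symm x y _ ih => exact Relation.EqvGen.symm _ _ ih
    | trans x y z _ _ ih ih' => exact Relation.EqvGen.trans _ _ _ ih ih'
  induction h with
  | rel x y h =>
    obtain ⟨f, rfl, rfl⟩ := h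
    intro v w hv hw
    have h1 := key _ _ (hφ v (X.bdry (Hom.flagMap φ f))
      (hv.trans (Hom.bdry_flagMap φ f).symm))
    have h2 := key _ _ (hφ (X.bdry (Hom.flagMap φ (Hom.ghost ψ f))) w
      ((Hom.bdry_flagMap φ _).trans hw.symm))
    refine Relation.EqvGen.trans _ _ _ h1 (Relation.EqvGen.trans _ _ _ ?_ h2)
    exact Relation.EqvGen.rel _ _ ⟨Hom.flagMap φ f, rfl,
      congrArg X.bdry (Hom.compGhost_flagMap φ ψ f)⟩
  | refl x => exact fun v w hv hw => key _ _ (hφ v w (hv.trans hw.symm))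
  | symm x y _ ih => exact fun v w hv hw => Relation.EqvGen.symm _ _ (ih w v hw hv)
  | trans x y z _ _ ih ih' =>
    intro v w hv hw
    obtain ⟨t, ht⟩ := Hom.vertMap_surjective φ y
    exact Relation.EqvGen.trans _ _ _ (ih v t hv ht) (ih' t w ht hw)

instance : ctd.{u}.IsMultiplicative where
  id_mem X := fun v w h => by
    have h' : v = w := h
    rw [h']
    exact Relation.EqvGen.refl _
  comp_mem φ ψ hφ hψ := fun v w h =>
    componentSetoid_comp_of_right φ ψ hφ (hψ _ _ h) v w rfl rfl

end Aggregate

/-- The category `Agg^ctd`: the wide subcategory of `Agg` of the morphisms in `Aggregate.ctd`. -/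
abbrev AggCtd : Type (u + 1) := WideSubcategory Aggregate.ctd.{u}

namespace AggCtd

/-- The ghost graph of a morphism of `Agg^ctd`. -/
def ghostGraph {X Y : AggCtd.{u}} (φ : X ⟶ Y) : BMGraph.{u} := Aggregate.ghostGraph φ.hom

/-- The isomorphism classes of objects of `(Agg^ctd ↓ Crl)`, that is, of the morphisms of `Agg^ctd`
whose target is a corolla. -/
def overCorollas : Set (MorClass AggCtd.{u}) :=
  { c | ∃ (X Y : AggCtd.{u}) (φ : X ⟶ Y), Y.obj.IsCorolla ∧ morClass φ = c }

end AggCtd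

/-! ### Factoring morphisms of aggregates -/

namespace Aggregate

/-! A morphism of `AggCtd` is determined by its ghost graph up to an isomorphism of the target:
because fibres are connected, the target's vertices are the components of the ghost graph, and its
flags are the fixed points of the ghost involution. Every involution of the flags of a source
arises, by contraction (`toContraction`).

The key is a universal property: `φ` factors through `ι` as soon as the ghost edges of `ι` are ghost
edges of `φ` (`exists_comp_eq`), and always conversely (`ghost_eq_or_eq_ghost_comp`). The factor is
unique, all morphisms being epimorphisms (`hom_left_cancel`), and it has connected fibres when `φ`
does (`ctd_of_comp`). So morphisms with the same source and ghost edges differ by a unique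
isomorphism of targets (`exists_iso_of_ghost_eq`).

This gives the classification (`classEquiv`) and, for a fixed `φ`, the bijection between classes of
decompositions and subsets of ghost edges (`decompEquiv`). The second factor lives on the contracted
graph, so its ghost graph is the quotient (`quotientIso`). The coproduct formula is then a
reindexing, and freeness is cancellation of an epimorphism. -/

theorem vertMap_eq_of_componentSetoid {X Y : Aggregate.{u}} (φ : X ⟶ Y) {v w : X.V}
    (h : (ghostGraph φ).componentSetoid v w) : Hom.vertMap φ v = Hom.vertMap φ w := by
  induction h with
  | rel x y h =>
    obtain ⟨f, rfl, rfl⟩ := h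
    exact (Hom.bdry_ghost φ f).symm
  | refl x => rfl
  | symm x y _ ih => exact ih.symm
  | trans x y z _ _ ih ih' => exact ih.trans ih'

/-- The morphisms of `Agg` are epimorphisms. -/
theorem hom_left_cancel {X Y Z : Aggregate.{u}} (ι : X ⟶ Y) {π π' : Y ⟶ Z}
    (h : ι ≫ π = ι ≫ π') : π = π' := by
  refine Hom.ext (funext fun f => ?_) (funext fun y => ?_) (funext fun f => ?_)
  · exact Hom.flagMap_injective ι (congrFun (congrArg Hom.flagMap h) f)
  · obtain ⟨x, rfl⟩ := Hom.vertMap_surjective ι y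
    exact congrFun (congrArg Hom.vertMap h) x
  · refine Hom.flagMap_injective ι ?_
    rw [← Hom.compGhost_flagMap ι π, ← Hom.compGhost_flagMap ι π']
    exact congrFun (congrArg Hom.ghost h) _

/-- A morphism `φ` factors through a morphism `ι` of `Agg^ctd` with the same source when each ghost
edge of `ι` is a ghost edge of `φ`. -/
theorem exists_comp_eq {X Y Z : Aggregate.{u}} (ι : X ⟶ Y) (φ : X ⟶ Z) (hι : ctd ι)
    (h : ∀ f, Hom.ghost ι f = f ∨ Hom.ghost ι f = Hom.ghost φ f) : ∃ π : Y ⟶ Z, ι ≫ π = φ := by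
  -- Fibres of `ι` are joined by ghost edges of `ι`, hence of `φ`, so the vertex map of `φ` descends
  -- to `Y`.
  have hvert : ∀ v w, Hom.vertMap ι v = Hom.vertMap ι w →
      Hom.vertMap φ v = Hom.vertMap φ w := by
    intro v w hvw
    have h' := hι v w hvw
    clear hvw
    induction h' with
    | rel x y hxy =>
      obtain ⟨f, rfl, rfl⟩ := hxy
      change Hom.vertMap φ (X.bdry f) = Hom.vertMap φ (X.bdry (Hom.ghost ι f))
      rcases h f with hf | hf
      · rw [hf]
      · rw [hf]
        exact (Hom.bdry_ghost φ f).symm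
    | refl x => rfl
    | symm x y _ ih => exact ih.symm
    | trans x y z _ _ ih ih' => exact ih.trans ih'
  -- By `hvert` the choice of section does not affect the vertex map of `π`.
  choose s hs using Hom.vertMap_surjective ι
  have hflag : ∀ g, ∃ y, Hom.flagMap ι y = Hom.flagMap φ g := by
    intro g
    refine (Hom.ghost_eq_self_iff ι _).1 ?_
    rcases h (Hom.flagMap φ g) with hf | hf
    · exact hf
    · rw [hf, Hom.ghost_flagMap φ]
  choose k hk using hflag
  -- The fixed flags of `ι` are stable under the ghost involution of `φ`: if `ι` sent the partner of
  -- a fixed flag back to that flag, then applying `ι`'s involution again would make the two equal.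
  have hghost : ∀ y, ∃ y', Hom.flagMap ι y' = Hom.ghost φ (Hom.flagMap ι y) := by
    intro y
    refine (Hom.ghost_eq_self_iff ι _).1 ?_
    rcases h (Hom.ghost φ (Hom.flagMap ι y)) with hf | hf
    · exact hf
    · rw [Hom.ghost_ghost φ] at hf
      have h' := Hom.ghost_ghost ι (Hom.ghost φ (Hom.flagMap ι y))
      rw [hf, Hom.ghost_flagMap ι] at h'
      rw [← h', Hom.ghost_flagMap ι]
  choose γ hγ using hghost
  have hbdry : ∀ y, Hom.vertMap φ (s (Y.bdry y)) = Hom.vertMap φ (X.bdry (Hom.flagMap ι y)) :=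
    fun y => hvert _ _ ((hs _).trans (Hom.bdry_flagMap ι y).symm)
  let π : Hom Y Z :=
    { flagMap := k
      vertMap := fun y => Hom.vertMap φ (s y)
      ghost := γ
      flagMap_injective := fun a b hab => Hom.flagMap_injective φ (by rw [← hk, ← hk, hab])
      vertMap_surjective := fun z => by
        obtain ⟨x, rfl⟩ := Hom.vertMap_surjective φ z
        exact ⟨Hom.vertMap ι x, hvert _ _ (hs _)⟩
      ghost_ghost := fun y => Hom.flagMap_injective ι (by rw [hγ, hγ, Hom.ghost_ghost φ])
      ghost_eq_self_iff := fun y => by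
        rw [← (Hom.flagMap_injective ι).eq_iff, hγ, Hom.ghost_eq_self_iff φ]
        refine exists_congr fun g => ?_
        rw [← hk, (Hom.flagMap_injective ι).eq_iff]
      bdry_flagMap := fun g => by rw [hbdry, hk, Hom.bdry_flagMap φ]
      bdry_ghost := fun y => by rw [hbdry, hbdry, hγ, Hom.bdry_ghost φ] }
  refine ⟨π, Hom.ext (funext hk) (funext fun v => hvert _ _ (hs _)) (funext fun f => ?_)⟩
  change Hom.compGhost ι π f = Hom.ghost φ f
  by_cases hf : f ∈ Set.range (Hom.flagMap ι)
  · obtain ⟨y, rfl⟩ := hf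
    rw [Hom.compGhost_flagMap ι π]
    exact hγ y
  · rw [Hom.compGhost_of_not_mem ι π hf]
    -- Outside the image of its flag map, `ι` moves every flag, so only the second alternative of
    -- `h` remains.
    exact (h f).resolve_left fun h' => hf ((Hom.ghost_eq_self_iff ι f).1 h')

/-- Composition keeps the ghost edges of the first factor. This is why a decomposition yields a
subgraph. -/
theorem ghost_eq_or_eq_ghost_comp {X Y Z : Aggregate.{u}} (ι : X ⟶ Y) (π : Y ⟶ Z) (f : X.F) :
    Hom.ghost ι f = f ∨ Hom.ghost ι f = Hom.ghost (ι ≫ π) f := by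
  by_cases hf : f ∈ Set.range (Hom.flagMap ι)
  · exact Or.inl ((Hom.ghost_eq_self_iff ι f).2 hf)
  · exact Or.inr (Hom.compGhost_of_not_mem ι π hf).symm

/-- A ghost edge of the composite either comes from one of `π`, or is one of `ι` and is collapsed to
a vertex. -/
theorem componentSetoid_of_comp {X Y Z : Aggregate.{u}} (ι : X ⟶ Y) (π : Y ⟶ Z) {v w : X.V}
    (h : (ghostGraph (ι ≫ π)).componentSetoid v w) :
    (ghostGraph π).componentSetoid (Hom.vertMap ι v) (Hom.vertMap ι w) := by
  induction h with
  | rel x y hxy =>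
    obtain ⟨f, rfl, rfl⟩ := hxy
    change (ghostGraph π).componentSetoid (Hom.vertMap ι (X.bdry f))
      (Hom.vertMap ι (X.bdry (Hom.compGhost ι π f)))
    by_cases hf : f ∈ Set.range (Hom.flagMap ι)
    · obtain ⟨y, rfl⟩ := hf
      rw [Hom.compGhost_flagMap ι π, Hom.bdry_flagMap ι, Hom.bdry_flagMap ι]
      exact Relation.EqvGen.rel _ _ ⟨y, rfl, rfl⟩
    · have h' : Hom.vertMap ι (X.bdry (Hom.ghost ι f)) = Hom.vertMap ι (X.bdry f) :=
        Hom.bdry_ghost ι f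
      rw [Hom.compGhost_of_not_mem ι π hf, h']
      exact Relation.EqvGen.refl _
  | refl x => exact Relation.EqvGen.refl _
  | symm x y _ ih => exact Relation.EqvGen.symm _ _ ih
  | trans x y z _ _ ih ih' => exact Relation.EqvGen.trans _ _ _ ih ih'

theorem ctd_of_comp {X Y Z : Aggregate.{u}} (ι : X ⟶ Y) (π : Y ⟶ Z) (h : ctd (ι ≫ π)) :
    ctd π := by
  intro a b hab
  obtain ⟨v, rfl⟩ := Hom.vertMap_surjective ι a
  obtain ⟨w, rfl⟩ := Hom.vertMap_surjective ι b
  exact componentSetoid_of_comp ι π (h v w hab)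

/-- The morphism of aggregates given by an isomorphism of the underlying graphs. -/
def homOfIso {X Y : Aggregate.{u}} (e : BMGraph.Iso X.toBMGraph Y.toBMGraph) : X ⟶ Y :=
  show Hom X Y from
  { flagMap := e.onF.symm
    vertMap := e.onV
    ghost := _root_.id
    flagMap_injective := e.onF.symm.injective
    vertMap_surjective := e.onV.surjective
    ghost_ghost := fun _ => rfl
    ghost_eq_self_iff := fun f => by simp
    bdry_flagMap := fun f => by rw [← e.bdry_onF, Equiv.apply_symm_apply]
    bdry_ghost := fun _ => rfl }

theorem ctd_homOfIso {X Y : Aggregate.{u}} (e : BMGraph.Iso X.toBMGraph Y.toBMGraph) :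
    ctd (homOfIso e) := by
  intro v w h
  rw [e.onV.injective h]
  exact Relation.EqvGen.refl _

theorem homOfIso_symm {X Y : Aggregate.{u}} (e : BMGraph.Iso X.toBMGraph Y.toBMGraph) :
    homOfIso e ≫ homOfIso e.symm = 𝟙 X := by
  refine Hom.ext (funext fun f => ?_) (funext fun v => ?_) (funext fun f => ?_)
  · exact e.onF.symm_apply_apply f
  · exact e.onV.symm_apply_apply v
  · change Hom.compGhost (homOfIso e) (homOfIso e.symm) f = f
    obtain ⟨g, rfl⟩ := e.onF.symm.surjective f
    exact Hom.compGhost_flagMap (homOfIso e) (homOfIso e.symm) g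

/-- The aggregate obtained from `X` by gluing flags with the involution `inv` and contracting the
components of the resulting graph. -/
def contraction (X : Aggregate.{u}) (inv : X.F → X.F) (hinv : ∀ f, inv (inv f) = f) :
    Aggregate.{u} where
  V := Quotient (BMGraph.mk X.V X.F X.bdry inv hinv).componentSetoid
  F := { f : X.F // inv f = f }
  bdry f := Quotient.mk _ (X.bdry f.1)
  inv f := f
  inv_inv _ := rfl
  no_edges _ := rfl

/-- The morphism with ghost involution `inv` onto the contraction. -/
def toContraction (X : Aggregate.{u}) (inv : X.F → X.F) (hinv : ∀ f, inv (inv f) = f) :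
    X ⟶ X.contraction inv hinv :=
  show Hom X (X.contraction inv hinv) from
  { flagMap := Subtype.val
    vertMap := Quotient.mk _
    ghost := inv
    flagMap_injective := Subtype.val_injective
    vertMap_surjective := Quotient.mk_surjective
    ghost_ghost := hinv
    ghost_eq_self_iff := fun f => ⟨fun h => ⟨⟨f, h⟩, rfl⟩, by rintro ⟨g, rfl⟩; exact g.2⟩
    bdry_flagMap := fun _ => rfl
    bdry_ghost := fun f => Quotient.sound (Relation.EqvGen.symm _ _
      (Relation.EqvGen.rel _ _ ⟨f, rfl, rfl⟩)) }

theorem ctd_toContraction (X : Aggregate.{u}) (inv : X.F → X.F) (hinv : ∀ f, inv (inv f) = f) :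
    ctd (X.toContraction inv hinv) :=
  fun _ _ h => Quotient.exact h

end Aggregate

/-! ### Ghost graphs classify the morphisms of `Agg^ctd` -/

namespace AggCtd

open Aggregate

theorem hom_left_cancel {X Y Z : AggCtd.{u}} (ι : X ⟶ Y) {π π' : Y ⟶ Z}
    (h : ι ≫ π = ι ≫ π') : π = π' :=
  WideSubcategory.hom_ext _ (Aggregate.hom_left_cancel ι.hom (congrArg (fun f => f.hom) h))

theorem exists_comp_eq {X Y Z : AggCtd.{u}} (ι : X ⟶ Y) (φ : X ⟶ Z)
    (h : ∀ f, Hom.ghost ι.hom f = f ∨ Hom.ghost ι.hom f = Hom.ghost φ.hom f) :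
    ∃ π : Y ⟶ Z, ι ≫ π = φ := by
  obtain ⟨π, hπ⟩ := Aggregate.exists_comp_eq ι.hom φ.hom ι.property h
  exact ⟨⟨π, ctd_of_comp ι.hom π (hπ ▸ φ.property)⟩, WideSubcategory.hom_ext _ hπ⟩

/-- Morphisms of `Agg^ctd` with the same source and the same ghost edges differ by an isomorphism
of targets. -/
theorem exists_iso_of_ghost_eq {X Y Y' : AggCtd.{u}} (ι : X ⟶ Y) (ι' : X ⟶ Y')
    (h : Hom.ghost ι.hom = Hom.ghost ι'.hom) : ∃ σ : Y ≅ Y', ι ≫ σ.hom = ι' := by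
  -- Each morphism factors through the other; the two factors are mutually inverse by cancellation.
  obtain ⟨π, hπ⟩ := exists_comp_eq ι ι' fun f => Or.inr (congrFun h f)
  obtain ⟨π', hπ'⟩ := exists_comp_eq ι' ι fun f => Or.inr (congrFun h f).symm
  refine ⟨⟨π, π', hom_left_cancel ι ?_, hom_left_cancel ι' ?_⟩, hπ⟩
  · rw [← Category.assoc, hπ, hπ', Category.comp_id]
  · rw [← Category.assoc, hπ', hπ, Category.comp_id]

/-- The isomorphism of aggregates given by an isomorphism of the underlying graphs. -/
noncomputable def isoOfIso {X Y : AggCtd.{u}} (e : BMGraph.Iso X.obj.toBMGraph Y.obj.toBMGraph) : X ≅ Y :=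
  WideSubcategory.isoMk ⟨homOfIso e, homOfIso e.symm, homOfIso_symm e, homOfIso_symm e.symm⟩
    (ctd_homOfIso e) (ctd_homOfIso e.symm)

theorem flagMap_inv_hom {X Y : AggCtd.{u}} (σ : X ≅ Y) (f : X.obj.F) :
    Hom.flagMap σ.hom.hom (Hom.flagMap σ.inv.hom f) = f :=
  congrFun (congrArg (fun φ : X ⟶ X => Hom.flagMap φ.hom) σ.hom_inv_id) f

theorem vertMap_hom_inv {X Y : AggCtd.{u}} (σ : X ≅ Y) (v : X.obj.V) :
    Hom.vertMap σ.inv.hom (Hom.vertMap σ.hom.hom v) = v :=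
  congrFun (congrArg (fun φ : X ⟶ X => Hom.vertMap φ.hom) σ.hom_inv_id) v

theorem ghost_iso {X Y : AggCtd.{u}} (σ : X ≅ Y) (f : X.obj.F) : Hom.ghost σ.hom.hom f = f :=
  (Hom.ghost_eq_self_iff _ f).2 ⟨_, flagMap_inv_hom σ f⟩

/-- An isomorphism has a surjective flag map, hence no ghost edges to contribute. -/
theorem ghost_comp_iso {X Y Y' : AggCtd.{u}} (φ : X ⟶ Y) (σ : Y ≅ Y') :
    Hom.ghost (φ ≫ σ.hom).hom = Hom.ghost φ.hom := by
  funext f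
  change Hom.compGhost φ.hom σ.hom.hom f = _
  by_cases hf : f ∈ Set.range (Hom.flagMap φ.hom)
  · obtain ⟨y, rfl⟩ := hf
    rw [Hom.compGhost_flagMap φ.hom, ghost_iso, Hom.ghost_flagMap φ.hom]
  · exact Hom.compGhost_of_not_mem φ.hom _ hf

/-- Isomorphic morphisms have isomorphic ghost graphs. -/
noncomputable def ghostGraphIso {φ ψ : Arrow AggCtd.{u}} (i : φ ≅ ψ) :
    BMGraph.Iso (ghostGraph φ.hom) (ghostGraph ψ.hom) where
  onV := ⟨Hom.vertMap i.hom.left.hom, Hom.vertMap i.inv.left.hom,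
    vertMap_hom_inv (Arrow.leftFunc.mapIso i), vertMap_hom_inv (Arrow.leftFunc.mapIso i.symm)⟩
  -- Flag maps are contravariant, so the inverse isomorphism is used here.
  onF := ⟨Hom.flagMap i.inv.left.hom, Hom.flagMap i.hom.left.hom,
    flagMap_inv_hom (Arrow.leftFunc.mapIso i), flagMap_inv_hom (Arrow.leftFunc.mapIso i.symm)⟩
  bdry_onF f := by
    change ψ.left.obj.bdry (Hom.flagMap i.inv.left.hom f) =
      Hom.vertMap i.hom.left.hom (φ.left.obj.bdry f)
    have h : Hom.vertMap i.inv.left.hom (ψ.left.obj.bdry (Hom.flagMap i.inv.left.hom f)) =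
      φ.left.obj.bdry f := Hom.bdry_flagMap i.inv.left.hom f
    exact (vertMap_hom_inv (Arrow.leftFunc.mapIso i.symm) _).symm.trans
      (congrArg (Hom.vertMap i.hom.left.hom) h)
  inv_onF f := by
    -- The ghost involutions of the two sides of the square of `i.inv` are compared: one is that of
    -- `ψ`, the other is that of `φ` carried along the flag map.
    have h := congrFun (congrArg (fun χ : ψ.left ⟶ φ.right => Hom.ghost χ.hom) (Arrow.w i.inv))
      (Hom.flagMap i.inv.left.hom f)
    have h' := congrFun (ghost_comp_iso ψ.hom (Arrow.rightFunc.mapIso i.symm))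
      (Hom.flagMap i.inv.left.hom f)
    exact (h'.symm.trans h.symm).trans (Hom.compGhost_flagMap i.inv.left.hom φ.hom.hom f)

/-- A ghost graph isomorphism is in particular an isomorphism of the sources. Precomposing `ψ` with
it gives a morphism with the source and ghost edges of `φ`, so `exists_iso_of_ghost_eq` supplies the
isomorphism of targets. -/
theorem nonempty_arrow_iso {φ ψ : Arrow AggCtd.{u}}
    (e : BMGraph.Iso (ghostGraph φ.hom) (ghostGraph ψ.hom)) : Nonempty (φ ≅ ψ) := by
  let e' : BMGraph.Iso φ.left.obj.toBMGraph ψ.left.obj.toBMGraph :=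
    { onV := e.onV
      onF := e.onF
      bdry_onF := e.bdry_onF
      inv_onF := fun f => by rw [φ.left.obj.no_edges, ψ.left.obj.no_edges] }
  have h : Hom.ghost φ.hom.hom = Hom.ghost ((isoOfIso e').hom ≫ ψ.hom).hom := by
    funext f
    obtain ⟨g, rfl⟩ := e.onF.symm.surjective f
    exact (e.symm.inv_onF g).trans
      (Hom.compGhost_flagMap (isoOfIso e').hom.hom ψ.hom.hom g).symm
  obtain ⟨σ, hσ⟩ := exists_iso_of_ghost_eq _ _ h
  exact ⟨Arrow.isoMk (isoOfIso e') σ hσ.symm⟩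

/-- The aggregate of the corollas of the vertices of a graph. -/
def ofGraph (Γ : BMGraph.{u}) : AggCtd.{u} :=
  ⟨{ V := Γ.V, F := Γ.F, bdry := Γ.bdry, inv := id, inv_inv := fun _ => rfl,
     no_edges := fun _ => rfl }⟩

/-- The contraction of a graph, a morphism with this ghost graph. -/
def contract (Γ : BMGraph.{u}) :
    ofGraph Γ ⟶ ⟨(ofGraph Γ).obj.contraction Γ.inv Γ.inv_inv⟩ :=
  ⟨(ofGraph Γ).obj.toContraction Γ.inv Γ.inv_inv, ctd_toContraction _ _ _⟩

/-- Isomorphism classes of morphisms of `Agg^ctd` are isomorphism classes of graphs. -/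
noncomputable def classEquiv : MorClass AggCtd.{u} ≃ BMGraph.Class.{u} where
  toFun := Quotient.lift (fun φ : Arrow AggCtd.{u} => (ghostGraph φ.hom).toClass)
    (by rintro φ ψ ⟨i⟩; exact Quotient.sound ⟨ghostGraphIso i⟩)
  invFun := Quotient.lift (fun Γ => morClass (contract Γ))
    (by rintro Γ Γ' ⟨e⟩; exact Quotient.sound (nonempty_arrow_iso e))
  left_inv c := by
    induction c using Quotient.inductionOn with
    -- Contracting the ghost graph of `φ` gives a morphism with literally the same ghost graph.
    | h φ => exact Quotient.sound (nonempty_arrow_iso (BMGraph.Iso.refl _))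
  right_inv c := by
    induction c using Quotient.inductionOn with
    | h Γ => rfl

theorem classEquiv_morClass {X Z : AggCtd.{u}} (φ : X ⟶ Z) :
    classEquiv (morClass φ) = (ghostGraph φ).toClass := rfl

/-! ### Decompositions and subgraphs -/

/-- The subgraph `Γ(φ₁)` of `Γ(φ)` for a decomposition `φ = φ₀ ∘ φ₁`. -/
def decompSubgraph {X Z : AggCtd.{u}} {φ : X ⟶ Z} (d : Factorisation φ) :
    (ghostGraph φ).Subgraph where
  inv := Hom.ghost d.ι.hom
  inv_inv := Hom.ghost_ghost d.ι.hom
  inv_eq f := by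
    have h := ghost_eq_or_eq_ghost_comp d.ι.hom d.π.hom f
    have h' : d.ι.hom ≫ d.π.hom = φ.hom := congrArg (fun χ => χ.hom) d.ι_π
    rwa [h'] at h

theorem decompSubgraph_eq_of_iso {X Z : AggCtd.{u}} {φ : X ⟶ Z} {d e : Factorisation φ}
    (i : d ≅ e) : decompSubgraph d = decompSubgraph e := by
  apply BMGraph.Subgraph.ext
  let σ : d.mid ≅ e.mid :=
    { hom := i.hom.h
      inv := i.inv.h
      hom_inv_id := congrArg Factorisation.Hom.h i.hom_inv_id
      inv_hom_id := congrArg Factorisation.Hom.h i.inv_hom_id }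
  change Hom.ghost d.ι.hom = Hom.ghost e.ι.hom
  rw [← ghost_comp_iso d.ι σ, ← i.hom.ι_h]

/-- Equal ghost edges give an isomorphism of middle objects compatible with the first factors;
compatibility with the second factors follows by cancelling `d.ι`. -/
theorem nonempty_iso_of_decompSubgraph_eq {X Z : AggCtd.{u}} {φ : X ⟶ Z} {d e : Factorisation φ}
    (h : decompSubgraph d = decompSubgraph e) : Nonempty (d ≅ e) := by
  obtain ⟨σ, hσ⟩ := exists_iso_of_ghost_eq d.ι e.ι (congrArg BMGraph.Subgraph.inv h)
  have hπ : σ.hom ≫ e.π = d.π := hom_left_cancel d.ι (by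
    rw [← Category.assoc, hσ, e.ι_π, d.ι_π])
  exact ⟨{ hom := { h := σ.hom, ι_h := hσ, h_π := hπ }
           inv := { h := σ.inv, ι_h := by rw [← hσ]; simp, h_π := by rw [← hπ]; simp }
           hom_inv_id := Factorisation.Hom.ext σ.hom_inv_id
           inv_hom_id := Factorisation.Hom.ext σ.inv_hom_id }⟩

/-- Contract the edges of `S` first; `S.inv_eq` is precisely the condition for `φ` to factor through
this contraction. -/
theorem exists_decompSubgraph_eq {X Z : AggCtd.{u}} (φ : X ⟶ Z) (S : (ghostGraph φ).Subgraph) :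
    ∃ d : Factorisation φ, decompSubgraph d = S := by
  let ι : X ⟶ ⟨X.obj.contraction S.inv S.inv_inv⟩ :=
    ⟨X.obj.toContraction S.inv S.inv_inv, ctd_toContraction _ _ _⟩
  obtain ⟨π, hπ⟩ := exists_comp_eq ι φ S.inv_eq
  exact ⟨⟨_, ι, π, hπ⟩, rfl⟩

/-- Classes of decompositions of `φ` correspond to the subgraphs of `Γ(φ)`. -/
noncomputable def decompEquiv {X Z : AggCtd.{u}} (φ : X ⟶ Z) :
    DecompClass φ ≃ (ghostGraph φ).Subgraph :=
  Equiv.ofBijective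
    (Quotient.lift decompSubgraph (by rintro d e ⟨i⟩; exact decompSubgraph_eq_of_iso i))
    ⟨fun c c' h => by
      induction c using Quotient.inductionOn with
      | h d =>
        induction c' using Quotient.inductionOn with
        | h e => exact Quotient.sound (nonempty_iso_of_decompSubgraph_eq h),
    fun S => by
      obtain ⟨d, hd⟩ := exists_decompSubgraph_eq φ S
      exact ⟨decompClass d, hd⟩⟩

theorem decompSubgraph_toGraph {X Z : AggCtd.{u}} {φ : X ⟶ Z} (d : Factorisation φ) :
    (decompSubgraph d).toGraph = ghostGraph d.ι := rfl

/-- The flags of the target of a morphism are the flags fixed by its ghost involution. -/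
noncomputable def flagEquiv {X Y : AggCtd.{u}} (ι : X ⟶ Y) :
    Y.obj.F ≃ { f : X.obj.F // Hom.ghost ι.hom f = f } :=
  Equiv.ofBijective (fun y => ⟨Hom.flagMap ι.hom y, Hom.ghost_flagMap ι.hom y⟩)
    ⟨fun _ _ h => Hom.flagMap_injective ι.hom (congrArg Subtype.val h),
    fun f => by
      obtain ⟨y, hy⟩ := (Hom.ghost_eq_self_iff ι.hom f.1).1 f.2
      exact ⟨y, Subtype.ext hy⟩⟩

/-- The vertices of the target of a morphism are the components of its ghost graph. -/
noncomputable def vertEquiv {X Y : AggCtd.{u}} (ι : X ⟶ Y) :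
    Quotient (ghostGraph ι).componentSetoid ≃ Y.obj.V :=
  Equiv.ofBijective
    (Quotient.lift (Hom.vertMap ι.hom) fun _ _ => vertMap_eq_of_componentSetoid ι.hom)
    ⟨fun a b h => by
      induction a using Quotient.inductionOn with
      | h v =>
        induction b using Quotient.inductionOn with
        -- Injectivity is the connectedness of the fibres of `ι`.
        | h w => exact Quotient.sound (ι.property v w h),
    fun y => by
      obtain ⟨x, rfl⟩ := Hom.vertMap_surjective ι.hom y
      exact ⟨Quotient.mk _ x, rfl⟩⟩

/-- `Γ(φ₀) = Γ(φ) / Γ(φ₁)` for a decomposition `φ = φ₀ ∘ φ₁`. -/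
noncomputable def quotientIso {X Z : AggCtd.{u}} {φ : X ⟶ Z} (d : Factorisation φ) :
    BMGraph.Iso (ghostGraph d.π) (decompSubgraph d).quotient where
  onV := (vertEquiv d.ι).symm
  onF := flagEquiv d.ι
  bdry_onF y := ((vertEquiv d.ι).symm_apply_eq.2 (Hom.bdry_flagMap d.ι.hom y).symm).symm
  inv_onF y := by
    have h : Hom.comp d.ι.hom d.π.hom = φ.hom := congrArg (fun χ => χ.hom) d.ι_π
    exact Subtype.ext ((congrFun (congrArg Hom.ghost h) _).symm.trans
      (Hom.compGhost_flagMap d.ι.hom d.π.hom y))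

theorem toClass_ghostGraph_π {X Z : AggCtd.{u}} {φ : X ⟶ Z} (d : Factorisation φ) :
    (ghostGraph d.π).toClass = (decompSubgraph d).quotient.toClass :=
  Quotient.sound ⟨quotientIso d⟩

/-! ### The coproduct as a sum over subgraphs -/

theorem decompTerm_eq {X Z : AggCtd.{u}} {φ : X ⟶ Z} (c : DecompClass φ) :
    decompTerm c = Finsupp.single (classEquiv.symm (decompEquiv φ c).quotient.toClass) 1 ⊗ₜ[ℤ]
      Finsupp.single (classEquiv.symm (decompEquiv φ c).toGraph.toClass) 1 := by
  induction c using Quotient.inductionOn with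
  | h d =>
    change Finsupp.single (morClass d.π) (1 : ℤ) ⊗ₜ[ℤ] Finsupp.single (morClass d.ι) (1 : ℤ) =
      Finsupp.single (classEquiv.symm (decompSubgraph d).quotient.toClass) 1 ⊗ₜ[ℤ]
        Finsupp.single (classEquiv.symm (decompSubgraph d).toGraph.toClass) 1
    rw [← toClass_ghostGraph_π, decompSubgraph_toGraph, ← classEquiv_morClass,
      ← classEquiv_morClass, Equiv.symm_apply_apply, Equiv.symm_apply_apply]

theorem decompSum_eq {X Z : AggCtd.{u}} (φ : X ⟶ Z) :
    decompSum φ = ∑ S : (ghostGraph φ).Subgraph,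
      Finsupp.single (classEquiv.symm S.quotient.toClass) 1 ⊗ₜ[ℤ]
        Finsupp.single (classEquiv.symm S.toGraph.toClass) 1 := by
  rw [← finsum_eq_sum_of_fintype]
  exact finsum_eq_of_bijective (decompEquiv φ) (decompEquiv φ).bijective decompTerm_eq

theorem deltaIso_single (Γ : BMGraph.{u}) :
    deltaIso AggCtd.{u} (Finsupp.single (classEquiv.symm Γ.toClass) 1) =
      ∑ S : Γ.Subgraph, Finsupp.single (classEquiv.symm S.quotient.toClass) 1 ⊗ₜ[ℤ]
        Finsupp.single (classEquiv.symm S.toGraph.toClass) 1 := by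
  rw [deltaIso, Finsupp.linearCombination_single, one_smul]
  -- The representative `contract Γ` has ghost graph `Γ` by definition, so the sum runs over the
  -- subgraphs of `Γ` itself.
  exact decompSum_eq (contract Γ)

theorem map_deltaIso :
    TensorProduct.map (Finsupp.lmapDomain ℤ ℤ classEquiv) (Finsupp.lmapDomain ℤ ℤ classEquiv) ∘ₗ
        deltaIso AggCtd.{u} =
      BMGraph.connesKreimerCoproduct.{u} ∘ₗ Finsupp.lmapDomain ℤ ℤ classEquiv := by
  refine Finsupp.lhom_ext' fun c => LinearMap.ext_ring ?_
  obtain ⟨x, rfl⟩ := classEquiv.symm.surjective c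
  induction x using Quotient.inductionOn with
  | h Γ =>
    change TensorProduct.map _ _ (deltaIso AggCtd.{u}
      (Finsupp.single (classEquiv.symm Γ.toClass) 1)) = BMGraph.connesKreimerCoproduct
        (Finsupp.lmapDomain ℤ ℤ classEquiv (Finsupp.single (classEquiv.symm Γ.toClass) 1))
    rw [deltaIso_single, map_sum, Finsupp.lmapDomain_apply, Finsupp.mapDomain_single,
      Equiv.apply_symm_apply, BMGraph.connesKreimerCoproduct, Finsupp.linearCombination_single,
      one_smul]
    refine Finset.sum_congr rfl fun S _ => ?_
    rw [TensorProduct.map_tmul, Finsupp.lmapDomain_apply, Finsupp.lmapDomain_apply,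
      Finsupp.mapDomain_single, Finsupp.mapDomain_single, Equiv.apply_symm_apply,
      Equiv.apply_symm_apply]

/-! ### Connected graphs and corollas -/

theorem mem_overCorollas {Γ : BMGraph.{u}} (h : Γ.Connected) :
    classEquiv.symm Γ.toClass ∈ overCorollas.{u} := by
  obtain ⟨⟨v⟩, hv⟩ := h
  refine ⟨_, _, contract Γ, ⟨Quotient.mk _ v, trivial, fun y _ => ?_⟩, rfl⟩
  obtain ⟨w, rfl⟩ := Quotient.mk_surjective y
  exact Quotient.sound (hv w v)

end AggCtd

/-- Paths of `Γ` project to paths of the quotient: an edge outside `S` survives, while an edge of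
`S` has both ends in one component and becomes constant. -/
theorem BMGraph.Connected.quotient {Γ : BMGraph.{u}} (h : Γ.Connected) (S : Γ.Subgraph) :
    S.quotient.Connected := by
  obtain ⟨⟨v⟩, hv⟩ := h
  have key : ∀ v w, Γ.componentSetoid v w → S.quotient.componentSetoid
      (Quotient.mk S.toGraph.componentSetoid v) (Quotient.mk S.toGraph.componentSetoid w) := by
    intro v w h
    induction h with
    | rel x y hxy =>
      obtain ⟨f, rfl, rfl⟩ := hxy
      by_cases hf : S.inv f = f
      · exact Relation.EqvGen.rel _ _ ⟨⟨f, hf⟩, rfl, rfl⟩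
      · have h' : Quotient.mk S.toGraph.componentSetoid (Γ.bdry f) =
            Quotient.mk S.toGraph.componentSetoid (Γ.bdry (Γ.inv f)) :=
          Quotient.sound (Relation.EqvGen.rel _ _
            ⟨f, rfl, congrArg Γ.bdry ((S.inv_eq f).resolve_left hf)⟩)
        rw [h']
        exact Relation.EqvGen.refl _
    | refl x => exact Relation.EqvGen.refl _
    | symm x y _ ih => exact Relation.EqvGen.symm _ _ ih
    | trans x y z _ _ ih ih' => exact Relation.EqvGen.trans _ _ _ ih ih'
  refine ⟨⟨Quotient.mk _ v⟩, fun a b => ?_⟩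
  obtain ⟨a, rfl⟩ := Quotient.mk_surjective a
  obtain ⟨b, rfl⟩ := Quotient.mk_surjective b
  exact key a b (hv a b)

theorem mainTheorem9 :
    -- the identification of isomorphism classes of morphisms with ghost graphs, `[φ] = Γ(φ)`
    ∃ e : MorClass AggCtd.{u} ≃ BMGraph.Class.{u},
      (∀ {X Z : AggCtd.{u}} (φ : X ⟶ Z),
        e (morClass φ) = (AggCtd.ghostGraph φ).toClass) ∧
      -- the sum that defines the coproduct is finite
      (∀ {X Z : AggCtd.{u}} (φ : X ⟶ Z), Finite (DecompClass φ)) ∧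
      -- the formula for the coproduct
      (∀ Γ : BMGraph.{u},
        deltaIso AggCtd.{u} (Finsupp.single (e.symm Γ.toClass) 1) =
          ∑ Γ₁ : Γ.Subgraph,
            Finsupp.single (e.symm Γ₁.quotient.toClass) 1 ⊗ₜ[ℤ]
              Finsupp.single (e.symm Γ₁.toGraph.toClass) 1) ∧
      -- it is the Connes–Kreimer coproduct of graphs
      (TensorProduct.map (Finsupp.lmapDomain ℤ ℤ e) (Finsupp.lmapDomain ℤ ℤ e) ∘ₗ
          deltaIso AggCtd.{u} =
        BMGraph.connesKreimerCoproduct.{u} ∘ₗ Finsupp.lmapDomain ℤ ℤ e) ∧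
      -- classes of decompositions `(φ₀, φ₁)` correspond to subgraphs, by `Γ₁ = Γ(φ₁)`, and then
      -- `Γ(φ₀) = Γ(φ) / Γ₁`
      (∀ {X Z : AggCtd.{u}} (φ : X ⟶ Z),
        ∃ b : DecompClass φ ≃ (AggCtd.ghostGraph φ).Subgraph,
          ∀ d : Factorisation φ,
            (b (decompClass d)).toGraph = AggCtd.ghostGraph d.ι ∧
            (AggCtd.ghostGraph d.π).toClass = (b (decompClass d)).quotient.toClass) ∧
      -- the action of the automorphisms of the middle object on decompositions is free
      (∀ {X Z : AggCtd.{u}} (φ : X ⟶ Z) (d : Factorisation φ) (σ : d.mid ≅ d.mid),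
        d.ι ≫ σ.hom = d.ι → σ.inv ≫ d.π = d.π → σ = Iso.refl d.mid) ∧
      -- if `Γ` is connected, then so is `Γ / Γ₁`, and both are classes of `(Agg^ctd ↓ Crl)`
      (∀ Γ : BMGraph.{u}, Γ.Connected →
        e.symm Γ.toClass ∈ AggCtd.overCorollas.{u} ∧
        ∀ Γ₁ : Γ.Subgraph, Γ₁.quotient.Connected ∧
          e.symm Γ₁.quotient.toClass ∈ AggCtd.overCorollas.{u}) := by
  refine ⟨AggCtd.classEquiv, AggCtd.classEquiv_morClass,
    fun φ => Finite.of_equiv _ (AggCtd.decompEquiv φ).symm, AggCtd.deltaIso_single,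
    AggCtd.map_deltaIso,
    fun φ => ⟨AggCtd.decompEquiv φ, fun d => ⟨rfl, AggCtd.toClass_ghostGraph_π d⟩⟩,
    -- Freeness: `σ.hom` and the identity agree after precomposition with the epimorphism `d.ι`.
    fun φ d σ h _ => Iso.ext (AggCtd.hom_left_cancel d.ι (h.trans (Category.comp_id d.ι).symm)),
    fun Γ hΓ => ⟨AggCtd.mem_overCorollas hΓ,
      fun Γ₁ => ⟨hΓ.quotient Γ₁, AggCtd.mem_overCorollas (hΓ.quotient Γ₁)⟩⟩⟩
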